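/- Let $b_1,b_2\in L_2[0,\pi]$ be real-valued, let $C=(c_{ik})$ be a real $2\times 2$ matrix, and let $\Omega=\{(c_{11}w_1+c_{12}w_2,\;c_{21}w_1+c_{22}w_2): w_1\ge 0,\ w_2\ge 0\}\subseteq\mathbb R^2$. For an initial state $\varphi\in L_2[0,\pi]$, consider the control system $$\frac{\partial x}{\partial t}(t,\xi)=\frac{\partial^2x}{\partial\xi^2}(t,\xi)+b_1(\xi)u_1(t)+b_2(\xi)u_2(t),\qquad x(t,0)=x(t,\pi)=0,\qquad x(0,\xi)=\varphi(\xi),$$ for $t\ge 0$, $0\le\xi\le\pi$. For a control $u\in L_2^{\rm loc}([0,\infty),\mathbb R^2)$, its weak solution is the continuous function $x:[0,\infty)\to L_2[0,\pi]$ with $x(0)=\varphi$ such that, for every $y\in C^2[0,\pi]$ with $y(0)=y(\pi)=0$ and every $t\ge 0$, $$(x(t),y)=(\varphi,y)+\int_0^t\bigl[(x(s),y'')+u_1(s)(b_1,y)+u_2(s)(b_2,y)\bigr]\,ds,\qquad (f,g)=\int_0^\pi f(\xi)g(\xi)\,d\xi .$$ The system is called approximately $\Omega$-controllable from $\varphi$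 if for every $x_1\in L_2[0,\pi]$ and every $\varepsilon>0$ there are a control $u\in L_2^{\rm loc}([0,\infty),\Omega)$ and a time $0<t_1<\infty$ such that the corresponding weak solution satisfies $\|x_1-x(t_1)\|<\varepsilon$. Then, for every $\varphi\in L_2[0,\pi]$ (in particular for $\varphi=0$), the system is approximately $\Omega$-controllable from $\varphi$ if and only if there is no nonzero integer $j$ (positive or negative) such that $$\int_0^\pi (b_1(\xi)c_{11}+b_2(\xi)c_{21})\sin(j\xi)\,d\xi\le 0\qquad\text{and}\qquad \int_0^\pi (b_1(\xi)c_{12}+b_2(\xi)c_{22})\sin(j\xi)\,d\xi\le 0 .$$ -/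

import Mathlib

open MeasureTheory Set

namespace HeatControl

/-- The state space `X = L₂[0, π]` of real square-integrable functions. -/
abbrev State : Type := Lp ℝ 2 (volume.restrict (Icc (0 : ℝ) Real.pi))

/-- The pairing `∫₀^π x(ξ) y(ξ) dξ` of a state with a function on `[0, π]`. -/
noncomputable def pairing (x : State) (y : ℝ → ℝ) : ℝ :=
  ∫ ξ in (0 : ℝ)..Real.pi, x ξ * y ξ

/-- The domain of the Dirichlet Laplacian: `y ∈ C²[0, π]` with `y(0) = y(π) = 0`. -/
def InDomain (y : ℝ → ℝ) : Prop :=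
  ContDiffOn ℝ 2 y (Icc 0 Real.pi) ∧ y 0 = 0 ∧ y Real.pi = 0

/-- The second derivative `y''` on `[0, π]` (one-sided at the end points). -/
noncomputable def laplacian (y : ℝ → ℝ) : ℝ → ℝ :=
  iteratedDerivWithin 2 y (Icc 0 Real.pi)

/-- The input operator `B : ℝ² → L₂[0, π]`, `(B v)(ξ) = b₁(ξ) v₁ + b₂(ξ) v₂`. -/
noncomputable def inputOp (b₁ b₂ : State) (v : Fin 2 → ℝ) : State :=
  v 0 • b₁ + v 1 • b₂

/-- The cone `Ω ⊆ ℝ²` of all `v = C w` with `w₁ ≥ 0` and `w₂ ≥ 0`. -/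
def cone (C : Matrix (Fin 2) (Fin 2) ℝ) : Set (Fin 2 → ℝ) :=
  {v | ∃ w : Fin 2 → ℝ, 0 ≤ w 0 ∧ 0 ≤ w 1 ∧ v = C.mulVec w}

/-- Admissible controls: `u ∈ L₂^loc([0, ∞), Ω)`. -/
def IsControl (Ω : Set (Fin 2 → ℝ)) (u : ℝ → Fin 2 → ℝ) : Prop :=
  (∀ T : ℝ, MemLp u 2 (volume.restrict (Icc 0 T))) ∧
    ∀ᵐ t ∂(volume.restrict (Ici (0 : ℝ))), u t ∈ Ω

/-- `x : [0, ∞) → L₂[0, π]` is the weak solution of `∂x/∂t = ∂²x/∂ξ² + B(ξ) u(t)` with Dirichlet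
boundary conditions and `x(0) = φ`: it is continuous in the norm of `L₂[0, π]`, and for each `y`
in the domain of the Dirichlet Laplacian, `t ↦ (x(t), y)` is an antiderivative of
`(x(t), y'') + (B u(t), y)` with value `(φ, y)` at `t = 0`. -/
def IsWeakSolution (b₁ b₂ φ : State) (u : ℝ → Fin 2 → ℝ) (x : ℝ → State) : Prop :=
  ContinuousOn x (Ici 0) ∧ x 0 = φ ∧
    ∀ y : ℝ → ℝ, InDomain y → ∀ t : ℝ, 0 ≤ t →
      pairing (x t) y = pairing φ y +
        ∫ s in (0 : ℝ)..t, (pairing (x s) (laplacian y) + pairing (inputOp b₁ b₂ (u s)) y)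

/-- Approximate `Ω`-controllability of the heat equation with initial state `φ`: each state can be
approximated arbitrarily well, at some positive time, by the solution for some `Ω`-valued
control. -/
def ApproxControllable (b₁ b₂ : State) (Ω : Set (Fin 2 → ℝ)) (φ : State) : Prop :=
  ∀ (x₁ : State) (ε : ℝ), 0 < ε →
    ∃ (u : ℝ → Fin 2 → ℝ) (t₁ : ℝ) (x : ℝ → State),
      IsControl Ω u ∧ 0 < t₁ ∧ IsWeakSolution b₁ b₂ φ u x ∧ ‖x₁ - x t₁‖ < ε

end HeatControl

namespace HeatControl

/-! In the orthonormal basis of normalized sines the equation decouples into scalar modes with decay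
rates (n+1)², each forced by the Fourier coefficient of `inputOp b₁ b₂ (u t)`. If some sin(jξ) pairs
nonpositively with both columns of B·C, every admissible control pushes that coefficient downward,
so it never exceeds |(φ, sin(jξ))| and most targets are out of reach (`not_approxControllable`).

Conversely, the states reachable from 0 form a convex cone. If it were not dense, Hahn–Banach would
give a functional f ≠ 0 that is nonpositive on it. Switching one column of C on for a time window
shows that f decreases along each step response; expanding this as an exponential sum and isolating
its slowest term gives a sign condition on the first mode N with f(`sineMode N`) ≠ 0
(`inner_mul_nonpos_of_antitone`). Since sine is odd, the sign of f there decides whether j = N+1 or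
j = -(N+1) violates the criterion. A general φ costs nothing, because its free evolution decays
exponentially. -/

/-! ### The pairing as an inner product, and orthogonality of the sines. -/

theorem memLp_of_continuousOn {y : ℝ → ℝ} (hy : ContinuousOn y (Icc 0 Real.pi)) :
    MemLp y 2 (volume.restrict (Icc (0 : ℝ) Real.pi)) := by
  obtain ⟨M, hM⟩ := isCompact_Icc.exists_bound_of_continuousOn hy
  refine MemLp.of_bound (hy.aestronglyMeasurable measurableSet_Icc) M ?_
  exact (ae_restrict_iff' measurableSet_Icc).2 (Filter.Eventually.of_forall hM)

theorem pairing_eq_setIntegral (x : State) (y : ℝ → ℝ) :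
    pairing x y = ∫ ξ in Icc (0 : ℝ) Real.pi, x ξ * y ξ := by
  rw [pairing, intervalIntegral.integral_of_le Real.pi_pos.le, integral_Icc_eq_integral_Ioc]

theorem pairing_eq_inner (x : State) {y : ℝ → ℝ}
    (hy : MemLp y 2 (volume.restrict (Icc (0 : ℝ) Real.pi))) :
    pairing x y = inner ℝ x (hy.toLp y) := by
  rw [pairing_eq_setIntegral, L2.inner_def]
  refine integral_congr_ae ?_
  filter_upwards [hy.coeFn_toLp] with ξ hξ
  rw [hξ]
  simp [mul_comm]

theorem inner_toLp_toLp {y z : ℝ → ℝ}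
    (hy : MemLp y 2 (volume.restrict (Icc (0 : ℝ) Real.pi)))
    (hz : MemLp z 2 (volume.restrict (Icc (0 : ℝ) Real.pi))) :
    inner ℝ (hy.toLp y) (hz.toLp z) = ∫ ξ in (0 : ℝ)..Real.pi, y ξ * z ξ := by
  rw [← pairing_eq_inner, pairing_eq_setIntegral,
    intervalIntegral.integral_of_le Real.pi_pos.le, ← integral_Icc_eq_integral_Ioc]
  refine integral_congr_ae ?_
  filter_upwards [hy.coeFn_toLp] with ξ hξ
  rw [hξ]

theorem pairing_congr (x : State) {y z : ℝ → ℝ} (h : EqOn y z (Icc 0 Real.pi)) :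
    pairing x y = pairing x z := by
  rw [pairing_eq_setIntegral, pairing_eq_setIntegral]
  exact setIntegral_congr_fun measurableSet_Icc fun ξ hξ => by simp only [h hξ]

theorem integrableOn_mul (x : State) {y : ℝ → ℝ} (hy : ContinuousOn y (Icc 0 Real.pi)) :
    IntegrableOn (fun ξ => x ξ * y ξ) (Icc 0 Real.pi) :=
  (Lp.memLp x).integrable_mul (memLp_of_continuousOn hy)

theorem memLp_sin (r : ℝ) :
    MemLp (fun ξ => Real.sin (r * ξ)) 2 (volume.restrict (Icc (0 : ℝ) Real.pi)) :=
  memLp_of_continuousOn (by fun_prop)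

theorem integral_sin_mul_sin (m n : ℕ) :
    ∫ ξ in (0 : ℝ)..Real.pi, Real.sin ((m + 1 : ℝ) * ξ) * Real.sin ((n + 1 : ℝ) * ξ) =
      if m = n then Real.pi / 2 else 0 := by
  have key : ∀ k : ℤ, k ≠ 0 → ∫ ξ in (0 : ℝ)..Real.pi, Real.cos ((k : ℝ) * ξ) = 0 := by
    intro k hk
    have hk' : (k : ℝ) ≠ 0 := by exact_mod_cast hk
    rw [intervalIntegral.integral_comp_mul_left (fun ξ => Real.cos ξ) hk', integral_cos]
    simp
  have e : ∀ ξ : ℝ, Real.sin ((m + 1 : ℝ) * ξ) * Real.sin ((n + 1 : ℝ) * ξ) =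
      (1 / 2) * (Real.cos (((m - n : ℤ) : ℝ) * ξ) - Real.cos (((m + n + 2 : ℤ) : ℝ) * ξ)) := by
    intro ξ
    push_cast
    have h1 : ((m : ℝ) - n) * ξ = (m + 1 : ℝ) * ξ - (n + 1 : ℝ) * ξ := by ring
    have h2 : ((m : ℝ) + n + 2) * ξ = (m + 1 : ℝ) * ξ + (n + 1 : ℝ) * ξ := by ring
    rw [h1, h2, Real.cos_sub, Real.cos_add]
    ring
  simp_rw [e]
  rw [intervalIntegral.integral_const_mul, intervalIntegral.integral_sub
    (Continuous.intervalIntegrable (by fun_prop) _ _)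
    (Continuous.intervalIntegrable (by fun_prop) _ _), key _ (by omega : (m + n + 2 : ℤ) ≠ 0)]
  split_ifs with h
  · subst h
    simp
    ring
  · rw [key _ (by omega)]
    simp

/-- The normalized Dirichlet eigenfunction `√(2/π) sin((n+1)ξ)`. -/
noncomputable def sineMode (n : ℕ) : State :=
  √(2 / Real.pi) • (memLp_sin (n + 1)).toLp _

theorem orthonormal_sineMode : Orthonormal ℝ sineMode := by
  rw [orthonormal_iff_ite]
  intro m n
  rw [sineMode, sineMode, real_inner_smul_left, real_inner_smul_right, inner_toLp_toLp,
    integral_sin_mul_sin, ← mul_assoc, Real.mul_self_sqrt (by positivity)]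
  split_ifs
  · field_simp
  · simp

/-! ### Completeness of the sine system. -/

/-- A state orthogonal to all sines `sin (n ξ)` is orthogonal to `sin ξ · p (cos ξ)` for every
polynomial `p`. -/
theorem pairing_sin_mul_aeval_cos (f : State)
    (hf : ∀ n : ℕ, pairing f (fun ξ => Real.sin ((n + 1 : ℝ) * ξ)) = 0) (p : Polynomial ℝ) :
    pairing f (fun ξ => Real.sin ξ * p.eval (Real.cos ξ)) = 0 := by
  have hadd : ∀ y z : ℝ → ℝ, Continuous y → Continuous z →
      pairing f (fun ξ => y ξ + z ξ) = pairing f y + pairing f z := by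
    intro y z hy hz
    rw [pairing_eq_setIntegral, pairing_eq_setIntegral, pairing_eq_setIntegral,
      ← integral_add (integrableOn_mul f hy.continuousOn) (integrableOn_mul f hz.continuousOn)]
    simp_rw [mul_add]
  have hsmul : ∀ (c : ℝ) (y : ℝ → ℝ), pairing f (fun ξ => c * y ξ) = c * pairing f y := by
    intro c y
    rw [pairing, pairing, ← intervalIntegral.integral_const_mul]
    congr 1
    ext ξ
    ring
  have hmon : ∀ k n : ℕ,
      pairing f (fun ξ => Real.sin ((n + 1 : ℝ) * ξ) * Real.cos ξ ^ k) = 0 := by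
    intro k
    induction k with
    | zero => simpa using hf
    | succ k ih =>
      intro n
      -- Product-to-sum trades one factor cos ξ for a shift of the frequency up and down by one. At
      -- n = 0 the lower frequency is 0 and its term vanishes.
      have e : (fun ξ => Real.sin ((n + 1 : ℝ) * ξ) * Real.cos ξ ^ (k + 1)) =
          fun ξ => (1 / 2) * (Real.sin (((n + 1 : ℕ) + 1 : ℝ) * ξ) * Real.cos ξ ^ k) +
            (1 / 2) * (Real.sin ((n : ℝ) * ξ) * Real.cos ξ ^ k) := by
        ext ξ
        have h1 : ((n + 1 : ℕ) + 1 : ℝ) * ξ = (n + 1 : ℝ) * ξ + ξ := by push_cast; ring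
        have h2 : (n : ℝ) * ξ = (n + 1 : ℝ) * ξ - ξ := by ring
        rw [h1, h2, Real.sin_add, Real.sin_sub]
        ring
      rw [e, hadd _ _ (by fun_prop) (by fun_prop), hsmul, hsmul, ih]
      cases n with
      | zero => simp [pairing]
      | succ n => simpa using ih n
  induction p using Polynomial.induction_on' with
  | add p q hp hq =>
    simp_rw [Polynomial.eval_add, mul_add]
    rw [hadd _ _ (by fun_prop) (by fun_prop), hp, hq, add_zero]
  | monomial k a =>
    have e : (fun ξ => Real.sin ξ * (Polynomial.monomial k a).eval (Real.cos ξ)) =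
        fun ξ => a * (Real.sin (((0 : ℕ) + 1 : ℝ) * ξ) * Real.cos ξ ^ k) := by
      ext ξ
      simp
      ring
    rw [e, hsmul, hmon, mul_zero]

/-- On [0, π] a continuous g is a continuous function of cos ξ, namely g ∘ arccos, so Weierstrass
approximation reduces it to polynomials in cos ξ. -/
theorem pairing_sin_mul_continuous (f : State)
    (hf : ∀ n : ℕ, pairing f (fun ξ => Real.sin ((n + 1 : ℝ) * ξ)) = 0)
    {g : ℝ → ℝ} (hg : Continuous g) :
    pairing f (fun ξ => Real.sin ξ * g ξ) = 0 := by
  set I := ∫ ξ in Icc (0 : ℝ) Real.pi, |f ξ| with hI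
  have hI0 : 0 ≤ I := integral_nonneg fun _ => abs_nonneg _
  have hfi : IntegrableOn (fun ξ => |f ξ|) (Icc 0 Real.pi) := by
    have := integrableOn_mul f (y := fun _ => 1) continuousOn_const
    simp only [mul_one] at this
    exact this.abs
  have hle : ∀ ε > 0, |pairing f (fun ξ => Real.sin ξ * g ξ)| ≤ ε * I := by
    intro ε hε
    obtain ⟨p, hp⟩ := exists_polynomial_near_of_continuousOn (-1) 1 (fun c => g (Real.arccos c))
      (by fun_prop) ε hε
    have h0 := pairing_sin_mul_aeval_cos f hf p
    rw [← sub_zero (pairing f _), ← h0, pairing_eq_setIntegral, pairing_eq_setIntegral,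
      ← integral_sub (integrableOn_mul f (by fun_prop)) (integrableOn_mul f (by fun_prop)),
      ← Real.norm_eq_abs, hI, ← integral_const_mul]
    refine norm_integral_le_of_norm_le (hfi.const_mul ε) ?_
    refine (ae_restrict_iff' measurableSet_Icc).2 (Filter.Eventually.of_forall fun ξ hξ => ?_)
    have h1 := hp (Real.cos ξ) ⟨Real.neg_one_le_cos ξ, Real.cos_le_one ξ⟩
    rw [Real.arccos_cos hξ.1 hξ.2, abs_sub_comm] at h1
    rw [← mul_sub, ← mul_sub, Real.norm_eq_abs, abs_mul, abs_mul, mul_comm]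
    gcongr
    calc |Real.sin ξ| * |g ξ - p.eval (Real.cos ξ)| ≤ 1 * ε :=
          mul_le_mul (Real.abs_sin_le_one ξ) h1.le (abs_nonneg _) zero_le_one
      _ = ε := one_mul ε
  by_contra hne
  have hpos := abs_pos.2 hne
  -- The summand 1 keeps the denominator positive when I = 0.
  have h2 := hle (|pairing f (fun ξ => Real.sin ξ * g ξ)| / (2 * (I + 1))) (by positivity)
  have h3 : |pairing f (fun ξ => Real.sin ξ * g ξ)| / (2 * (I + 1)) * I <
      |pairing f (fun ξ => Real.sin ξ * g ξ)| := by
    rw [div_mul_eq_mul_div, div_lt_iff₀ (by positivity)]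
    nlinarith
  linarith

/-- The function f · sin integrates to zero against all smooth test functions, so it vanishes almost
everywhere; sin ξ > 0 inside the interval then allows division. -/
theorem eq_zero_of_pairing_sin_eq_zero (f : State)
    (hf : ∀ n : ℕ, pairing f (fun ξ => Real.sin ((n + 1 : ℝ) * ξ)) = 0) : f = 0 := by
  have hint : IntegrableOn (fun ξ => f ξ * Real.sin ξ) (Icc 0 Real.pi) :=
    integrableOn_mul f (by fun_prop)
  have h0 : ∀ᵐ ξ ∂(volume.restrict (Icc (0 : ℝ) Real.pi)), f ξ * Real.sin ξ = 0 := by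
    refine ae_eq_zero_of_integral_contDiff_smul_eq_zero (Integrable.locallyIntegrable hint) ?_
    intro g hg _
    have := pairing_sin_mul_continuous f hf hg.continuous
    rw [pairing_eq_setIntegral] at this
    refine Eq.trans (integral_congr_ae (Filter.Eventually.of_forall fun ξ => ?_)) this
    simp only [smul_eq_mul]
    ring
  have hIoo : ∀ᵐ ξ ∂(volume.restrict (Icc (0 : ℝ) Real.pi)), ξ ∈ Ioo (0 : ℝ) Real.pi := by
    rw [← restrict_Ioo_eq_restrict_Icc]
    exact ae_restrict_mem measurableSet_Ioo
  refine Lp.ext ?_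
  filter_upwards [h0, hIoo, Lp.coeFn_zero ℝ 2 (volume.restrict (Icc (0 : ℝ) Real.pi))]
    with ξ h1 h2 h3
  rw [h3]
  exact (mul_eq_zero.1 h1).resolve_right (Real.sin_pos_of_pos_of_lt_pi h2.1 h2.2).ne'

theorem inner_sineMode (x : State) (n : ℕ) :
    inner ℝ (sineMode n) x =
      √(2 / Real.pi) * pairing x (fun ξ => Real.sin ((n + 1 : ℝ) * ξ)) := by
  rw [sineMode, real_inner_smul_left, real_inner_comm, ← pairing_eq_inner]

/-- The Dirichlet eigenfunctions form a Hilbert basis of `L₂[0, π]`. -/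
noncomputable def sineBasis : HilbertBasis ℕ ℝ State :=
  HilbertBasis.mkOfOrthogonalEqBot orthonormal_sineMode <| by
    rw [Submodule.eq_bot_iff]
    intro f hf
    refine eq_zero_of_pairing_sin_eq_zero f fun n => ?_
    have h := Submodule.inner_right_of_mem_orthogonal
      (Submodule.subset_span (mem_range_self (f := sineMode) n)) hf
    rw [inner_sineMode] at h
    exact (mul_eq_zero.1 h).resolve_left (by positivity)

@[simp]
theorem sineBasis_apply (n : ℕ) : sineBasis n = sineMode n := by
  simp [sineBasis]

/-! ### Test functions and the Dirichlet Laplacian. -/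

theorem InDomain.continuousOn {y : ℝ → ℝ} (hy : InDomain y) : ContinuousOn y (Icc 0 Real.pi) :=
  hy.1.continuousOn

theorem InDomain.continuousOn_laplacian {y : ℝ → ℝ} (hy : InDomain y) :
    ContinuousOn (laplacian y) (Icc 0 Real.pi) :=
  hy.1.continuousOn_iteratedDerivWithin le_rfl (uniqueDiffOn_Icc Real.pi_pos)

/-- Integration by parts against an eigenfunction. -/
theorem InDomain.integral_sin_mul_laplacian {y : ℝ → ℝ} (hy : InDomain y) (n : ℕ) :
    ∫ ξ in (0 : ℝ)..Real.pi, Real.sin ((n + 1 : ℝ) * ξ) * laplacian y ξ =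
      -(n + 1 : ℝ) ^ 2 * ∫ ξ in (0 : ℝ)..Real.pi, Real.sin ((n + 1 : ℝ) * ξ) * y ξ := by
  have hu := uniqueDiffOn_Icc Real.pi_pos
  have hI : uIcc (0 : ℝ) Real.pi = Icc 0 Real.pi := uIcc_of_le Real.pi_pos.le
  have hpi : Real.sin ((n + 1 : ℝ) * Real.pi) = 0 := by
    exact_mod_cast Real.sin_nat_mul_pi (n + 1)
  set y' := derivWithin y (Icc 0 Real.pi) with hy'
  have hy1 : ∀ ξ ∈ uIcc (0 : ℝ) Real.pi, HasDerivWithinAt y (y' ξ) (uIcc 0 Real.pi) ξ := by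
    rw [hI]
    exact fun ξ hξ => (hy.1.differentiableOn (by norm_num) ξ hξ).hasDerivWithinAt
  have hone : iteratedDerivWithin 1 y (Icc 0 Real.pi) = y' := by
    ext ξ
    rw [iteratedDerivWithin_one]
  have hlap : laplacian y = derivWithin y' (Icc 0 Real.pi) := by
    rw [laplacian, iteratedDerivWithin_succ, hone]
  have hy2 : ∀ ξ ∈ uIcc (0 : ℝ) Real.pi,
      HasDerivWithinAt y' (laplacian y ξ) (uIcc 0 Real.pi) ξ := by
    rw [hI, hlap, ← hone]
    exact fun ξ hξ =>
      (hy.1.differentiableOn_iteratedDerivWithin (by norm_num) hu ξ hξ).hasDerivWithinAt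
  have hy1i : IntervalIntegrable y' volume 0 Real.pi := by
    refine ContinuousOn.intervalIntegrable ?_
    rw [hI, ← hone]
    exact hy.1.continuousOn_iteratedDerivWithin (by norm_num) hu
  have hy2i : IntervalIntegrable (laplacian y) volume 0 Real.pi := by
    refine ContinuousOn.intervalIntegrable ?_
    rw [hI]
    exact hy.continuousOn_laplacian
  have hs : ∀ ξ ∈ uIcc (0 : ℝ) Real.pi, HasDerivWithinAt (fun ξ => Real.sin ((n + 1 : ℝ) * ξ))
      ((n + 1 : ℝ) * Real.cos ((n + 1 : ℝ) * ξ)) (uIcc 0 Real.pi) ξ := by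
    intro ξ _
    have := ((hasDerivAt_id ξ).const_mul (n + 1 : ℝ)).sin
    refine (this.congr_deriv ?_).hasDerivWithinAt
    simp [mul_comm]
  have hc : ∀ ξ ∈ uIcc (0 : ℝ) Real.pi, HasDerivWithinAt
      (fun ξ => (n + 1 : ℝ) * Real.cos ((n + 1 : ℝ) * ξ))
      (-(n + 1 : ℝ) ^ 2 * Real.sin ((n + 1 : ℝ) * ξ)) (uIcc 0 Real.pi) ξ := by
    intro ξ _
    have := (((hasDerivAt_id ξ).const_mul (n + 1 : ℝ)).cos).const_mul (n + 1 : ℝ)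
    refine (this.congr_deriv ?_).hasDerivWithinAt
    simp
    ring
  rw [intervalIntegral.integral_mul_deriv_eq_deriv_mul_of_hasDerivWithinAt hs hy2
      (Continuous.intervalIntegrable (by fun_prop) _ _) hy2i,
    intervalIntegral.integral_mul_deriv_eq_deriv_mul_of_hasDerivWithinAt hc hy1
      (Continuous.intervalIntegrable (by fun_prop) _ _) hy1i, hpi, hy.2.1, hy.2.2,
      ← intervalIntegral.integral_const_mul]
  simp [mul_assoc]

/-! ### Weak solutions built mode by mode. -/

theorem hasSum_inner_sineMode_mul (x y : State) :
    HasSum (fun n => inner ℝ (sineMode n) x * inner ℝ (sineMode n) y) (inner ℝ x y) := by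
  simpa only [sineBasis_apply, real_inner_comm x] using sineBasis.hasSum_inner_mul_inner x y

theorem summable_inner_sineMode_sq (x : State) :
    Summable fun n => inner ℝ (sineMode n) x ^ 2 := by
  simpa only [sq] using (hasSum_inner_sineMode_mul x x).summable

theorem ext_inner_sineMode {x y : State}
    (h : ∀ n, inner ℝ (sineMode n) x = inner ℝ (sineMode n) y) : x = y := by
  refine ext_inner_right ℝ fun v => ?_
  refine (hasSum_inner_sineMode_mul x v).unique ?_
  simp_rw [h]
  exact hasSum_inner_sineMode_mul y v

theorem exists_state_of_coeff_le {c a : ℕ → ℝ} (ha : Summable fun n => a n ^ 2)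
    (hc : ∀ n, |c n| ≤ a n) : ∃ x : State, ∀ n, inner ℝ (sineMode n) x = c n := by
  have hmem : Memℓp c 2 := by
    refine memℓp_gen ?_
    refine Summable.of_nonneg_of_le (fun n => by positivity) (fun n => ?_) ha
    simp only [ENNReal.toReal_ofNat, Real.rpow_ofNat, Real.norm_eq_abs]
    gcongr
    exact hc n
  refine ⟨sineBasis.repr.symm ⟨c, hmem⟩, fun n => ?_⟩
  rw [← sineBasis_apply, ← sineBasis.repr_apply_apply]
  simp

/-- A path of states whose Fourier coefficients are continuous and dominated by a square-summable
sequence is continuous. -/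
theorem continuousOn_of_coeff {x : ℝ → State} {a : ℕ → ℝ} {T : Set ℝ}
    (ha : Summable fun n => a n ^ 2)
    (hb : ∀ t ∈ T, ∀ n, |inner ℝ (sineMode n) (x t)| ≤ a n)
    (hc : ∀ n, ContinuousOn (fun t => inner ℝ (sineMode n) (x t)) T) : ContinuousOn x T := by
  intro t ht
  rw [ContinuousWithinAt, tendsto_iff_norm_sub_tendsto_zero]
  have hsq : ∀ s, ‖x s - x t‖ =
      √(∑' n, (inner ℝ (sineMode n) (x s) - inner ℝ (sineMode n) (x t)) ^ 2) := by
    intro s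
    have := (hasSum_inner_sineMode_mul (x s - x t) (x s - x t)).tsum_eq
    rw [real_inner_self_eq_norm_sq] at this
    simp_rw [← sq, inner_sub_right] at this
    rw [this, Real.sqrt_sq (norm_nonneg _)]
  have hlim : Filter.Tendsto
      (fun s => ∑' n, (inner ℝ (sineMode n) (x s) - inner ℝ (sineMode n) (x t)) ^ 2)
      (nhdsWithin t T) (nhds (∑' _ : ℕ, (0 : ℝ))) := by
    -- Two coefficients bounded by a n differ by at most 2 a n, whence the factor 4.
    refine tendsto_tsum_of_dominated_convergence (ha.mul_left 4) (fun n => ?_) ?_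
    · have h1 : Filter.Tendsto (fun s => inner ℝ (sineMode n) (x s) - inner ℝ (sineMode n) (x t))
          (nhdsWithin t T) (nhds 0) := by
        simpa using (hc n t ht).tendsto.sub_const (inner ℝ (sineMode n) (x t))
      simpa using h1.pow 2
    · filter_upwards [self_mem_nhdsWithin] with s hs n
      have h1 := abs_le.1 (hb s hs n)
      have h2 := abs_le.1 (hb t ht n)
      rw [Real.norm_eq_abs, abs_of_nonneg (sq_nonneg _)]
      nlinarith
  have := (Real.continuous_sqrt.tendsto _).comp hlim
  simp only [tsum_zero, Real.sqrt_zero] at this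
  exact this.congr fun s => (hsq s).symm

/-- The input operator has finite rank, so only scalar integrals of the control components are
needed and no integral of a state-valued function. -/
theorem integral_inner_inputOp (z b₁ b₂ : State) {u : ℝ → Fin 2 → ℝ} {t : ℝ}
    (hu : ∀ i, IntervalIntegrable (fun s => u s i) volume 0 t) :
    ∫ s in (0 : ℝ)..t, inner ℝ z (inputOp b₁ b₂ (u s)) =
      inner ℝ z (inputOp b₁ b₂ fun i => ∫ s in (0 : ℝ)..t, u s i) := by
  simp only [inputOp, inner_add_right, real_inner_smul_right]
  rw [intervalIntegral.integral_add ((hu 0).mul_const _) ((hu 1).mul_const _),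
    intervalIntegral.integral_mul_const, intervalIntegral.integral_mul_const]

theorem intervalIntegrable_inner_inputOp (z b₁ b₂ : State) {u : ℝ → Fin 2 → ℝ} {t : ℝ}
    (hu : ∀ i, IntervalIntegrable (fun s => u s i) volume 0 t) :
    IntervalIntegrable (fun s => inner ℝ z (inputOp b₁ b₂ (u s))) volume 0 t := by
  simp only [inputOp, inner_add_right, real_inner_smul_right]
  exact ((hu 0).mul_const _).add ((hu 1).mul_const _)

theorem intervalIntegrable_pairing_inputOp (b₁ b₂ : State) {u : ℝ → Fin 2 → ℝ} {t : ℝ}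
    (hu : ∀ i, IntervalIntegrable (fun s => u s i) volume 0 t) {y : ℝ → ℝ}
    (hy : ContinuousOn y (Icc 0 Real.pi)) :
    IntervalIntegrable (fun s => pairing (inputOp b₁ b₂ (u s)) y) volume 0 t := by
  simp_rw [pairing_eq_inner _ (memLp_of_continuousOn hy),
    real_inner_comm ((memLp_of_continuousOn hy).toLp y)]
  exact intervalIntegrable_inner_inputOp _ _ _ hu

theorem intervalIntegrable_pairing {x : ℝ → State} (hx : ContinuousOn x (Ici 0)) {t : ℝ}
    (ht : 0 ≤ t) {y : ℝ → ℝ} (hy : ContinuousOn y (Icc 0 Real.pi)) :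
    IntervalIntegrable (fun s => pairing (x s) y) volume 0 t := by
  simp_rw [pairing_eq_inner _ (memLp_of_continuousOn hy)]
  refine ContinuousOn.intervalIntegrable ?_
  rw [uIcc_of_le ht]
  exact (hx.mono Icc_subset_Ici_self).inner continuousOn_const

theorem InDomain.inner_sineMode_laplacian {y : ℝ → ℝ} (hy : InDomain y) (n : ℕ) :
    inner ℝ (sineMode n) ((memLp_of_continuousOn hy.continuousOn_laplacian).toLp _) =
      -(n + 1 : ℝ) ^ 2 * inner ℝ (sineMode n) ((memLp_of_continuousOn hy.continuousOn).toLp _) := by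
  rw [sineMode, real_inner_smul_left, real_inner_smul_left, inner_toLp_toLp, inner_toLp_toLp,
    hy.integral_sin_mul_laplacian]
  ring

/-- A path whose Fourier coefficients solve the modal equations in integrated form, with a
square-summable bound, is a weak solution. -/
theorem isWeakSolution_of_coeff {b₁ b₂ φ : State} {u : ℝ → Fin 2 → ℝ} {x : ℝ → State}
    {a : ℕ → ℝ} (ha : Summable fun n => a n ^ 2)
    (hb : ∀ t ∈ Ici (0 : ℝ), ∀ n, |inner ℝ (sineMode n) (x t)| ≤ a n)
    (hc : ∀ n, ContinuousOn (fun t => inner ℝ (sineMode n) (x t)) (Ici 0))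
    (hu : ∀ t, 0 ≤ t → ∀ i, IntervalIntegrable (fun s => u s i) volume 0 t)
    (heq : ∀ n t, 0 ≤ t → inner ℝ (sineMode n) (x t) = inner ℝ (sineMode n) φ +
      ∫ s in (0 : ℝ)..t, (-(n + 1 : ℝ) ^ 2 * inner ℝ (sineMode n) (x s) +
        inner ℝ (sineMode n) (inputOp b₁ b₂ (u s)))) :
    IsWeakSolution b₁ b₂ φ u x := by
  have hx := continuousOn_of_coeff ha hb hc
  refine ⟨hx, ext_inner_sineMode fun n => by simpa using heq n 0 le_rfl, ?_⟩
  intro y hy t ht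
  have hsub : uIcc 0 t ⊆ Ici (0 : ℝ) := by rw [uIcc_of_le ht]; exact Icc_subset_Ici_self
  rw [intervalIntegral.integral_add (intervalIntegrable_pairing hx ht hy.continuousOn_laplacian)
    (intervalIntegrable_pairing_inputOp b₁ b₂ (hu t ht) hy.continuousOn)]
  simp_rw [pairing_eq_inner _ (memLp_of_continuousOn hy.continuousOn),
    pairing_eq_inner _ (memLp_of_continuousOn hy.continuousOn_laplacian)]
  set Y := (memLp_of_continuousOn hy.continuousOn).toLp y with hY
  set Z := (memLp_of_continuousOn hy.continuousOn_laplacian).toLp (laplacian y) with hZ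
  have hYZ : ∀ n, inner ℝ (sineMode n) Z = -(n + 1 : ℝ) ^ 2 * inner ℝ (sineMode n) Y :=
    hy.inner_sineMode_laplacian
  have hU : ∫ s in (0 : ℝ)..t, inner ℝ (inputOp b₁ b₂ (u s)) Y =
      inner ℝ (inputOp b₁ b₂ fun i => ∫ s in (0 : ℝ)..t, u s i) Y := by
    simp_rw [real_inner_comm Y]
    exact integral_inner_inputOp Y b₁ b₂ (hu t ht)
  have hbound : Summable fun n => a n * |inner ℝ (sineMode n) Z| := by
    refine Summable.of_nonneg_of_le
      (fun n => mul_nonneg ((abs_nonneg _).trans (hb t ht n)) (abs_nonneg _)) (fun n => ?_)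
      (ha.add (summable_inner_sineMode_sq Z))
    rw [← sq_abs (inner ℝ (sineMode n) Z)]
    nlinarith [sq_nonneg (a n - |inner ℝ (sineMode n) Z|), sq_nonneg (a n),
      sq_nonneg |inner ℝ (sineMode n) Z|]
  -- Parseval under the time integral: the sum and the integral are exchanged by dominated
  -- convergence, with the time-independent majorant `hbound`.
  have hZsum : HasSum
      (fun n => ∫ s in (0 : ℝ)..t, inner ℝ (sineMode n) (x s) * inner ℝ (sineMode n) Z)
      (∫ s in (0 : ℝ)..t, inner ℝ (x s) Z) := by
    refine intervalIntegral.hasSum_integral_of_dominated_convergence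
      (fun n _ => a n * |inner ℝ (sineMode n) Z|) (fun n => ?_) (fun n => ?_) ?_ ?_ ?_
    · exact ((((hc n).mono hsub).mul_const _).mono uIoc_subset_uIcc).aestronglyMeasurable
        measurableSet_uIoc
    · refine Filter.Eventually.of_forall fun s hs => ?_
      rw [Real.norm_eq_abs, abs_mul]
      exact mul_le_mul_of_nonneg_right (hb s (hsub (uIoc_subset_uIcc hs)) n) (abs_nonneg _)
    · exact Filter.Eventually.of_forall fun _ _ => hbound
    · exact intervalIntegrable_const
    · exact Filter.Eventually.of_forall fun s _ => hasSum_inner_sineMode_mul (x s) Z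
  have htot := ((hasSum_inner_sineMode_mul φ Y).add (hZsum.add
    (hasSum_inner_sineMode_mul (inputOp b₁ b₂ fun i => ∫ s in (0 : ℝ)..t, u s i) Y)))
  rw [hU]
  refine (hasSum_inner_sineMode_mul (x t) Y).unique ?_
  convert htot using 1
  ext n
  rw [heq n t ht, intervalIntegral.integral_add
    (((hc n).mono hsub).intervalIntegrable.const_mul _)
    (intervalIntegrable_inner_inputOp _ b₁ b₂ (hu t ht)), integral_inner_inputOp _ _ _ (hu t ht),
    intervalIntegral.integral_const_mul, intervalIntegral.integral_mul_const, hYZ]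
  ring

/-! ### Free evolution. -/

theorem exists_freeEvolution (φ : State) : ∃ x : ℝ → State, ∀ t, 0 ≤ t → ∀ n,
    inner ℝ (sineMode n) (x t) = Real.exp (-(n + 1 : ℝ) ^ 2 * t) * inner ℝ (sineMode n) φ := by
  -- At negative times the factors grow and need not give a square-summable sequence, so the
  -- requirement is void there.
  have : ∀ t : ℝ, ∃ z : State, 0 ≤ t → ∀ n,
      inner ℝ (sineMode n) z = Real.exp (-(n + 1 : ℝ) ^ 2 * t) * inner ℝ (sineMode n) φ := by
    intro t
    by_cases ht : 0 ≤ t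
    · obtain ⟨z, hz⟩ := exists_state_of_coeff_le
        (c := fun n => Real.exp (-(n + 1 : ℝ) ^ 2 * t) * inner ℝ (sineMode n) φ)
        (a := fun n => |inner ℝ (sineMode n) φ|)
        (by simpa only [sq_abs] using summable_inner_sineMode_sq φ) (fun n => by
          rw [abs_mul, abs_of_pos (Real.exp_pos _)]
          refine mul_le_of_le_one_left (abs_nonneg _) (Real.exp_le_one_iff.2 ?_)
          have : 0 ≤ (n + 1 : ℝ) ^ 2 * t := by positivity
          linarith)
      exact ⟨z, fun _ => hz⟩
    · exact ⟨0, fun h => absurd h ht⟩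
  choose x hx using this
  exact ⟨x, hx⟩

/-- The semigroup of the Dirichlet Laplacian, for nonnegative times. -/
noncomputable def freeEvolution (φ : State) : ℝ → State :=
  (exists_freeEvolution φ).choose

theorem inner_freeEvolution (φ : State) {t : ℝ} (ht : 0 ≤ t) (n : ℕ) :
    inner ℝ (sineMode n) (freeEvolution φ t) =
      Real.exp (-(n + 1 : ℝ) ^ 2 * t) * inner ℝ (sineMode n) φ :=
  (exists_freeEvolution φ).choose_spec t ht n

theorem isWeakSolution_freeEvolution (b₁ b₂ φ : State) :
    IsWeakSolution b₁ b₂ φ (fun _ => 0) (freeEvolution φ) := by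
  have hE : ∀ n, EqOn (fun t => inner ℝ (sineMode n) (freeEvolution φ t))
      (fun t => Real.exp (-(n + 1 : ℝ) ^ 2 * t) * inner ℝ (sineMode n) φ) (Ici 0) :=
    fun n t ht => inner_freeEvolution φ ht n
  refine isWeakSolution_of_coeff (a := fun n => |inner ℝ (sineMode n) φ|)
    (by simpa only [sq_abs] using summable_inner_sineMode_sq φ) (fun t ht n => ?_) (fun n => ?_)
    (fun t _ i => intervalIntegrable_const) (fun n t ht => ?_)
  · rw [inner_freeEvolution φ ht, abs_mul, abs_of_pos (Real.exp_pos _)]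
    refine mul_le_of_le_one_left (abs_nonneg _) (Real.exp_le_one_iff.2 ?_)
    have : 0 ≤ (n + 1 : ℝ) ^ 2 * t := mul_nonneg (by positivity) ht
    linarith
  · exact ContinuousOn.congr (by fun_prop) (hE n)
  · have hint : ∫ s in (0 : ℝ)..t, (-(n + 1 : ℝ) ^ 2 * inner ℝ (sineMode n) (freeEvolution φ s) +
        inner ℝ (sineMode n) (inputOp b₁ b₂ 0)) =
        ∫ s in (0 : ℝ)..t, -(n + 1 : ℝ) ^ 2 *
          (Real.exp (-(n + 1 : ℝ) ^ 2 * s) * inner ℝ (sineMode n) φ) := by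
      refine intervalIntegral.integral_congr fun s hs => ?_
      rw [uIcc_of_le ht] at hs
      simp [inner_freeEvolution φ hs.1, inputOp]
    rw [hint, intervalIntegral.integral_eq_sub_of_hasDerivAt
      (f := fun s => Real.exp (-(n + 1 : ℝ) ^ 2 * s) * inner ℝ (sineMode n) φ)
      (fun s _ => ?_) (Continuous.intervalIntegrable (by fun_prop) _ _),
      inner_freeEvolution φ ht]
    · simp
    · have := (((hasDerivAt_id s).const_mul (-(n + 1 : ℝ) ^ 2)).exp).mul_const
        (inner ℝ (sineMode n) φ)
      refine this.congr_deriv ?_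
      simp
      ring

/-- Every decay rate is at least 1, so Parseval compares the two norms term by term. -/
theorem norm_freeEvolution_le (φ : State) {t : ℝ} (ht : 0 ≤ t) :
    ‖freeEvolution φ t‖ ≤ Real.exp (-t) * ‖φ‖ := by
  refine abs_le_of_sq_le_sq' ?_ (by positivity) |>.2
  rw [mul_pow, ← real_inner_self_eq_norm_sq, ← real_inner_self_eq_norm_sq]
  refine hasSum_le (fun n => ?_) (hasSum_inner_sineMode_mul _ _)
    ((hasSum_inner_sineMode_mul φ φ).mul_left (Real.exp (-t) ^ 2))
  rw [inner_freeEvolution φ ht]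
  have h1 : Real.exp (-(n + 1 : ℝ) ^ 2 * t) ≤ Real.exp (-t) := by
    refine Real.exp_le_exp.2 ?_
    have : 0 ≤ (n : ℝ) ^ 2 * t + 2 * n * t := by positivity
    nlinarith
  have h2 := pow_le_pow_left₀ (Real.exp_pos _).le h1 2
  nlinarith [mul_le_mul_of_nonneg_right h2 (mul_self_nonneg (inner ℝ (sineMode n) φ))]

/-! ### Step responses. -/

/-- The response of the mode with eigenvalue `-lam` to a unit step. -/
noncomputable def modeResponse (lam r : ℝ) : ℝ :=
  (1 - Real.exp (-lam * max r 0)) / lam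

theorem continuous_modeResponse (lam : ℝ) : Continuous (modeResponse lam) := by
  unfold modeResponse
  fun_prop

theorem modeResponse_of_nonpos (lam : ℝ) {r : ℝ} (hr : r ≤ 0) : modeResponse lam r = 0 := by
  simp [modeResponse, hr]

theorem modeResponse_nonneg {lam : ℝ} (hl : 1 ≤ lam) (r : ℝ) : 0 ≤ modeResponse lam r := by
  have h : Real.exp (-lam * max r 0) ≤ 1 := by
    refine Real.exp_le_one_iff.2 ?_
    have : 0 ≤ lam * max r 0 := mul_nonneg (by linarith) (le_max_right _ _)
    linarith
  exact div_nonneg (by linarith) (by linarith)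

theorem modeResponse_le_one {lam : ℝ} (hl : 1 ≤ lam) (r : ℝ) : modeResponse lam r ≤ 1 := by
  rw [modeResponse, div_le_one (by linarith)]
  linarith [Real.exp_pos (-lam * max r 0)]

/-- The response has a kink at the switching time a, so the fundamental theorem is used with right
derivatives. The closed ray `Ici a` makes the integrand at a equal to the right derivative there. -/
theorem modeResponse_sub_eq_integral {lam a t : ℝ} (hl : 1 ≤ lam) (ha : 0 ≤ a) :
    modeResponse lam (t - a) = ∫ s in (0 : ℝ)..t,
      (-lam * modeResponse lam (s - a) + (Ici a).indicator (fun _ => (1 : ℝ)) s) := by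
  rw [intervalIntegral.integral_eq_sub_of_hasDeriv_right
    (f := fun s => modeResponse lam (s - a))]
  · rw [modeResponse_of_nonpos lam (by linarith : 0 - a ≤ 0), sub_zero]
  · exact ((continuous_modeResponse lam).comp (continuous_sub_right a)).continuousOn
  · intro s _
    rcases lt_or_ge s a with hs | hs
    · rw [modeResponse_of_nonpos lam (by linarith : s - a ≤ 0),
        indicator_of_notMem (by simpa using hs)]
      have h0 : HasDerivAt (fun _ : ℝ => (0 : ℝ)) 0 s := hasDerivAt_const s 0
      simp only [mul_zero, add_zero]
      refine (h0.congr_of_eventuallyEq ?_).hasDerivWithinAt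
      filter_upwards [Iio_mem_nhds hs] with r hr
      exact modeResponse_of_nonpos lam (by linarith [mem_Iio.1 hr])
    · have hval : ∀ r, a ≤ r →
          modeResponse lam (r - a) = (1 - Real.exp (-lam * (r - a))) / lam := fun r hr => by
        rw [modeResponse, max_eq_left (by linarith)]
      have hd : HasDerivAt (fun r => (1 - Real.exp (-lam * (r - a))) / lam)
          (Real.exp (-lam * (s - a))) s := by
        have := ((((hasDerivAt_id s).sub_const a).const_mul (-lam)).exp.const_sub 1).div_const lam
        refine this.congr_deriv ?_
        have : lam ≠ 0 := by linarith
        simp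
        field_simp
      have he : -lam * modeResponse lam (s - a) + (Ici a).indicator (fun _ => (1 : ℝ)) s =
          Real.exp (-lam * (s - a)) := by
        rw [hval s hs, indicator_of_mem (mem_Ici.2 hs)]
        have : lam ≠ 0 := by linarith
        field_simp
        ring
      rw [he]
      exact hd.hasDerivWithinAt.congr (fun r hr => hval r (hs.trans (le_of_lt hr))) (hval s hs)
  · refine IntervalIntegrable.add (Continuous.intervalIntegrable ?_ _ _) ?_
    · exact continuous_const.mul ((continuous_modeResponse lam).comp (continuous_sub_right a))
    · rw [intervalIntegrable_iff]
      exact (integrableOn_const (by simp)).indicator measurableSet_Ici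

theorem one_le_sq_succ (n : ℕ) : (1 : ℝ) ≤ (n + 1 : ℝ) ^ 2 :=
  one_le_pow₀ (by linarith [n.cast_nonneg (α := ℝ)])

theorem abs_modeResponse_mul_le (g : State) (r : ℝ) (n : ℕ) :
    |modeResponse ((n + 1 : ℝ) ^ 2) r * inner ℝ (sineMode n) g| ≤ |inner ℝ (sineMode n) g| := by
  rw [abs_mul, abs_of_nonneg (modeResponse_nonneg (one_le_sq_succ n) r)]
  exact mul_le_of_le_one_left (abs_nonneg _) (modeResponse_le_one (one_le_sq_succ n) r)

theorem exists_stepResponse (g : State) (r : ℝ) : ∃ z : State, ∀ n,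
    inner ℝ (sineMode n) z = modeResponse ((n + 1 : ℝ) ^ 2) r * inner ℝ (sineMode n) g :=
  exists_state_of_coeff_le (a := fun n => |inner ℝ (sineMode n) g|)
    (by simpa only [sq_abs] using summable_inner_sineMode_sq g) (abs_modeResponse_mul_le g r)

/-- The state reached from `0` after time `r` under the constant forcing term `g`. -/
noncomputable def stepResponse (g : State) (r : ℝ) : State :=
  (exists_stepResponse g r).choose

theorem inner_stepResponse (g : State) (r : ℝ) (n : ℕ) :
    inner ℝ (sineMode n) (stepResponse g r) =
      modeResponse ((n + 1 : ℝ) ^ 2) r * inner ℝ (sineMode n) g :=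
  (exists_stepResponse g r).choose_spec n

theorem isWeakSolution_stepResponse (b₁ b₂ : State) (v : Fin 2 → ℝ) {a : ℝ} (ha : 0 ≤ a) :
    IsWeakSolution b₁ b₂ 0 ((Ici a).indicator fun _ => v)
      (fun t => stepResponse (inputOp b₁ b₂ v) (t - a)) := by
  have hind : ∀ s i, (Ici a).indicator (fun _ => v) s i = (Ici a).indicator (fun _ => v i) s := by
    intro s i
    by_cases hs : s ∈ Ici a <;> simp [hs]
  refine isWeakSolution_of_coeff (a := fun n => |inner ℝ (sineMode n) (inputOp b₁ b₂ v)|)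
    (by simpa only [sq_abs] using summable_inner_sineMode_sq _) (fun t _ n => ?_) (fun n => ?_)
    (fun t _ i => ?_) (fun n t ht => ?_)
  · rw [inner_stepResponse]
    exact abs_modeResponse_mul_le _ _ n
  · simp_rw [inner_stepResponse]
    exact (((continuous_modeResponse _).comp (continuous_sub_right a)).mul_const _).continuousOn
  · simp_rw [hind]
    rw [intervalIntegrable_iff]
    exact (integrableOn_const (by simp)).indicator measurableSet_Ici
  · rw [inner_stepResponse, modeResponse_sub_eq_integral (one_le_sq_succ n) ha, inner_zero_right,
      zero_add, ← intervalIntegral.integral_mul_const]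
    congr 1
    ext s
    rw [inner_stepResponse]
    by_cases hs : s ∈ Ici a
    · simp only [hs, indicator_of_mem]
      ring
    · simp only [hs, not_false_eq_true, indicator_of_notMem]
      simp [inputOp]
      ring

/-! ### Superposition and the cone of reachable states. -/

theorem IsControl.intervalIntegrable {Ω : Set (Fin 2 → ℝ)} {u : ℝ → Fin 2 → ℝ}
    (hu : IsControl Ω u) {t : ℝ} (ht : 0 ≤ t) (i : Fin 2) :
    IntervalIntegrable (fun s => u s i) volume 0 t := by
  rw [intervalIntegrable_iff_integrableOn_Icc_of_le ht]
  exact ((hu.1 t).integrable one_le_two).eval i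

theorem inputOp_lincomb (b₁ b₂ : State) (α β : ℝ) (v w : Fin 2 → ℝ) :
    inputOp b₁ b₂ (α • v + β • w) = α • inputOp b₁ b₂ v + β • inputOp b₁ b₂ w := by
  simp only [inputOp, Pi.add_apply, Pi.smul_apply, smul_eq_mul]
  module

theorem pairing_lincomb (α β : ℝ) (x z : State) {y : ℝ → ℝ}
    (hy : ContinuousOn y (Icc 0 Real.pi)) :
    pairing (α • x + β • z) y = α * pairing x y + β * pairing z y := by
  simp_rw [pairing_eq_inner _ (memLp_of_continuousOn hy), inner_add_left, real_inner_smul_left]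

theorem IsWeakSolution.lincomb {b₁ b₂ φ ψ : State} {u v : ℝ → Fin 2 → ℝ} {x z : ℝ → State}
    (hx : IsWeakSolution b₁ b₂ φ u x) (hz : IsWeakSolution b₁ b₂ ψ v z)
    (hu : ∀ t, 0 ≤ t → ∀ i, IntervalIntegrable (fun s => u s i) volume 0 t)
    (hv : ∀ t, 0 ≤ t → ∀ i, IntervalIntegrable (fun s => v s i) volume 0 t) (α β : ℝ) :
    IsWeakSolution b₁ b₂ (α • φ + β • ψ) (fun t => α • u t + β • v t)
      (fun t => α • x t + β • z t) := by
  refine ⟨(hx.1.const_smul α).add (hz.1.const_smul β), by simp only [hx.2.1, hz.2.1],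
    fun y hy t ht => ?_⟩
  have ix := (intervalIntegrable_pairing hx.1 ht hy.continuousOn_laplacian).add
    (intervalIntegrable_pairing_inputOp b₁ b₂ (hu t ht) hy.continuousOn)
  have iz := (intervalIntegrable_pairing hz.1 ht hy.continuousOn_laplacian).add
    (intervalIntegrable_pairing_inputOp b₁ b₂ (hv t ht) hy.continuousOn)
  simp_rw [inputOp_lincomb, pairing_lincomb α β _ _ hy.continuousOn,
    pairing_lincomb α β _ _ hy.continuousOn_laplacian]
  rw [hx.2.2 y hy t ht, hz.2.2 y hy t ht, mul_add, mul_add,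
    ← intervalIntegral.integral_const_mul, ← intervalIntegral.integral_const_mul,
    add_add_add_comm, ← intervalIntegral.integral_add (ix.const_mul α) (iz.const_mul β)]
  congr 2
  ext s
  ring

theorem lincomb_mem_cone {C : Matrix (Fin 2) (Fin 2) ℝ} {v w : Fin 2 → ℝ} (hv : v ∈ cone C)
    (hw : w ∈ cone C) {α β : ℝ} (hα : 0 ≤ α) (hβ : 0 ≤ β) : α • v + β • w ∈ cone C := by
  obtain ⟨p, hp0, hp1, rfl⟩ := hv
  obtain ⟨q, hq0, hq1, rfl⟩ := hw
  refine ⟨α • p + β • q, ?_, ?_, ?_⟩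
  · simp only [Pi.add_apply, Pi.smul_apply, smul_eq_mul]; positivity
  · simp only [Pi.add_apply, Pi.smul_apply, smul_eq_mul]; positivity
  · rw [Matrix.mulVec_add, Matrix.mulVec_smul, Matrix.mulVec_smul]

theorem zero_mem_cone (C : Matrix (Fin 2) (Fin 2) ℝ) : (0 : Fin 2 → ℝ) ∈ cone C :=
  ⟨0, le_rfl, le_rfl, by simp⟩

theorem col_mem_cone (C : Matrix (Fin 2) (Fin 2) ℝ) (k : Fin 2) : (fun i => C i k) ∈ cone C := by
  refine ⟨Pi.single k 1, ?_, ?_, ?_⟩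
  · exact (Pi.single_nonneg.2 zero_le_one : (0 : Fin 2 → ℝ) ≤ Pi.single k 1) 0
  · exact (Pi.single_nonneg.2 zero_le_one : (0 : Fin 2 → ℝ) ≤ Pi.single k 1) 1
  · ext i
    simp

theorem IsControl.lincomb {C : Matrix (Fin 2) (Fin 2) ℝ} {u v : ℝ → Fin 2 → ℝ}
    (hu : IsControl (cone C) u) (hv : IsControl (cone C) v) {α β : ℝ} (hα : 0 ≤ α) (hβ : 0 ≤ β) :
    IsControl (cone C) fun t => α • u t + β • v t := by
  refine ⟨fun T => ((hu.1 T).const_smul α).add ((hv.1 T).const_smul β), ?_⟩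
  filter_upwards [hu.2, hv.2] with t h1 h2
  exact lincomb_mem_cone h1 h2 hα hβ

/-- The states that are reached from the origin at all sufficiently large times. -/
def reachable (b₁ b₂ : State) (C : Matrix (Fin 2) (Fin 2) ℝ) : Set State :=
  {z | ∃ T : ℝ, 0 < T ∧ ∀ t, T ≤ t → ∃ (u : ℝ → Fin 2 → ℝ) (x : ℝ → State),
    IsControl (cone C) u ∧ IsWeakSolution b₁ b₂ 0 u x ∧ x t = z}

/-- Because a reachable state is attained at all large times, two of them can be attained at a
common time, and superposition applies. -/
theorem lincomb_mem_reachable {b₁ b₂ : State} {C : Matrix (Fin 2) (Fin 2) ℝ} {y z : State}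
    (hy : y ∈ reachable b₁ b₂ C) (hz : z ∈ reachable b₁ b₂ C) {α β : ℝ} (hα : 0 ≤ α)
    (hβ : 0 ≤ β) : α • y + β • z ∈ reachable b₁ b₂ C := by
  obtain ⟨T, hT, hy⟩ := hy
  obtain ⟨S, hS, hz⟩ := hz
  refine ⟨max T S, lt_max_of_lt_left hT, fun t ht => ?_⟩
  obtain ⟨u, x, hu, hx, hxt⟩ := hy t ((le_max_left _ _).trans ht)
  obtain ⟨v, w, hv, hw, hwt⟩ := hz t ((le_max_right _ _).trans ht)
  refine ⟨_, fun s => α • x s + β • w s, hu.lincomb hv hα hβ, ?_, by simp only [hxt, hwt]⟩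
  simpa using hx.lincomb hw (fun t ht i => hu.intervalIntegrable ht i)
    (fun t ht i => hv.intervalIntegrable ht i) α β

theorem convex_reachable (b₁ b₂ : State) (C : Matrix (Fin 2) (Fin 2) ℝ) :
    Convex ℝ (reachable b₁ b₂ C) :=
  fun _ hy _ hz _ _ hα hβ _ => lincomb_mem_reachable hy hz hα hβ

theorem intervalIntegrable_indicator_Ici (v : Fin 2 → ℝ) (a t : ℝ) (i : Fin 2) :
    IntervalIntegrable (fun s => (Ici a).indicator (fun _ => v) s i) volume 0 t := by
  have hind : (fun s => (Ici a).indicator (fun _ => v) s i) = (Ici a).indicator (fun _ => v i) := by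
    ext s
    by_cases hs : s ∈ Ici a <;> simp [hs]
  rw [hind, intervalIntegrable_iff]
  exact (integrableOn_const (by simp)).indicator measurableSet_Ici

/-- The control equals v on [t - s, t - r) and 0 elsewhere. It is a difference of two steps, so its
values are checked directly to lie in the cone, which need not be closed under subtraction. -/
theorem stepResponse_sub_mem_reachable (b₁ b₂ : State) {C : Matrix (Fin 2) (Fin 2) ℝ}
    {v : Fin 2 → ℝ} (hv : v ∈ cone C) {r s : ℝ} (hr : 0 ≤ r) (hrs : r ≤ s) :
    stepResponse (inputOp b₁ b₂ v) s - stepResponse (inputOp b₁ b₂ v) r ∈ reachable b₁ b₂ C := by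
  refine ⟨s + 1, by linarith, fun t ht => ?_⟩
  have h1 := isWeakSolution_stepResponse b₁ b₂ v (a := t - s) (by linarith)
  have h2 := isWeakSolution_stepResponse b₁ b₂ v (a := t - r) (by linarith)
  have h3 := h1.lincomb h2 (fun t _ => intervalIntegrable_indicator_Ici v _ t)
    (fun t _ => intervalIntegrable_indicator_Ici v _ t) 1 (-1)
  rw [smul_zero, smul_zero, add_zero] at h3
  refine ⟨_, _, ⟨fun T => ?_, ?_⟩, h3, ?_⟩
  · exact (((memLp_const v).indicator measurableSet_Ici).const_smul (1 : ℝ)).add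
      (((memLp_const v).indicator measurableSet_Ici).const_smul (-1 : ℝ))
  · refine Filter.Eventually.of_forall fun τ => ?_
    by_cases hs : t - s ≤ τ
    · by_cases hr' : t - r ≤ τ
      · simpa [hs, hr', indicator] using zero_mem_cone C
      · simpa [hs, hr', indicator] using hv
    · have hr' : ¬ t - r ≤ τ := fun h => hs (by linarith)
      simpa [hs, hr', indicator] using zero_mem_cone C
  · simp only [sub_sub_cancel]
    module

theorem zero_mem_reachable (b₁ b₂ : State) (C : Matrix (Fin 2) (Fin 2) ℝ) :
    (0 : State) ∈ reachable b₁ b₂ C := by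
  simpa using stepResponse_sub_mem_reachable b₁ b₂ (zero_mem_cone C) (le_refl (0 : ℝ)) le_rfl

/-! ### Exponential sums and density of the reachable states. -/

theorem tendsto_tsum_exp_mul {k d : ℕ → ℝ} (hd : Summable d) (hk : ∀ n, d n = 0 ∨ 0 ≤ k n) :
    Filter.Tendsto (fun τ : ℝ => ∑' n, Real.exp (-k n * τ) * d n) Filter.atTop
      (nhds (∑' n, if k n = 0 then d n else 0)) := by
  refine tendsto_tsum_of_dominated_convergence hd.norm (fun n => ?_) ?_
  · by_cases h0 : k n = 0
    · simp [h0]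
    · rw [if_neg h0]
      rcases hk n with hn | hn
      · simp [hn]
      · have hpos : 0 < k n := lt_of_le_of_ne hn (Ne.symm h0)
        have h1 : Filter.Tendsto (fun τ : ℝ => Real.exp (-k n * τ)) Filter.atTop (nhds 0) :=
          Real.tendsto_exp_atBot.comp
            (Filter.tendsto_id.const_mul_atTop_of_neg (neg_lt_zero.2 hpos))
        simpa using h1.mul_const (d n)
  · filter_upwards [Filter.eventually_ge_atTop (0 : ℝ)] with τ hτ n
    rw [norm_mul, Real.norm_eq_abs (Real.exp _), abs_of_pos (Real.exp_pos _)]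
    rcases hk n with hn | hn
    · simp [hn]
    · refine mul_le_of_le_one_left (norm_nonneg _) (Real.exp_le_one_iff.2 ?_)
      have := mul_nonneg hn hτ
      linarith

/-- The leading coefficient of an exponential sum that is nonpositive at all positive times is
nonpositive. -/
theorem leading_coeff_nonpos {d : ℕ → ℝ} (hd : Summable d) {N : ℕ} (hN : ∀ n < N, d n = 0)
    (hneg : ∀ τ : ℝ, 0 ≤ τ → ∑' n : ℕ, Real.exp (-(n + 1 : ℝ) ^ 2 * τ) * d n ≤ 0) : d N ≤ 0 := by
  have hiff : ∀ n : ℕ, ((n + 1 : ℝ) ^ 2 - (N + 1 : ℝ) ^ 2 = 0) ↔ n = N := by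
    intro n
    rw [sub_eq_zero, sq_eq_sq₀ (by positivity) (by positivity), add_left_inj, Nat.cast_inj]
  -- Multiplying by exp((N+1)² τ) freezes the term n = N. The exponents that become growing have n <
  -- N, where d vanishes, so the limit is d N.
  have h := tendsto_tsum_exp_mul (k := fun n => (n + 1 : ℝ) ^ 2 - (N + 1 : ℝ) ^ 2) hd (fun n => by
    rcases lt_or_ge n N with hn | hn
    · exact Or.inl (hN n hn)
    · refine Or.inr (sub_nonneg.2 ?_)
      have : (N : ℝ) ≤ n := by exact_mod_cast hn
      gcongr)
  simp only [hiff, tsum_ite_eq] at h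
  refine le_of_tendsto h ?_
  filter_upwards [Filter.eventually_ge_atTop (0 : ℝ)] with τ hτ
  have he : ∑' n : ℕ, Real.exp (-((n + 1 : ℝ) ^ 2 - (N + 1 : ℝ) ^ 2) * τ) * d n =
      Real.exp ((N + 1 : ℝ) ^ 2 * τ) * ∑' n : ℕ, Real.exp (-(n + 1 : ℝ) ^ 2 * τ) * d n := by
    rw [← tsum_mul_left]
    congr 1
    ext n
    rw [← mul_assoc, ← Real.exp_add]
    congr 2
    ring
  rw [he]
  exact mul_nonpos_of_nonneg_of_nonpos (Real.exp_pos _).le (hneg τ hτ)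

theorem hasSum_clm_apply (f : State →L[ℝ] ℝ) (x : State) :
    HasSum (fun n => inner ℝ (sineMode n) x * f (sineMode n)) (f x) := by
  have := (sineBasis.hasSum_repr x).mapL f
  simpa [sineBasis.repr_apply_apply] using this

/-- If a functional decreases along the step response to `g`, its first nonzero Fourier
coefficient and the corresponding coefficient of `g` do not have the same strict sign. -/
theorem inner_mul_nonpos_of_antitone {f : State →L[ℝ] ℝ} {g : State}
    (hf : ∀ r s : ℝ, 0 ≤ r → r ≤ s → f (stepResponse g s) ≤ f (stepResponse g r)) {N : ℕ}
    (hN : ∀ n < N, f (sineMode n) = 0) :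
    inner ℝ (sineMode N) g * f (sineMode N) ≤ 0 := by
  set c : ℕ → ℝ := fun n => inner ℝ (sineMode n) g * f (sineMode n) with hc
  -- These are the modal contributions to the limiting value of f along the step response.
  set d : ℕ → ℝ := fun n => c n / (n + 1 : ℝ) ^ 2 with hd
  have hcs : Summable c := (hasSum_clm_apply f g).summable
  have hds : Summable d := by
    refine Summable.of_norm_bounded hcs.norm fun n => ?_
    rw [hd, norm_div, Real.norm_of_nonneg (by positivity : (0 : ℝ) ≤ (n + 1 : ℝ) ^ 2)]
    exact div_le_self (norm_nonneg _) (one_le_sq_succ n)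
  have hes : ∀ τ : ℝ, 0 ≤ τ → Summable fun n : ℕ => Real.exp (-(n + 1 : ℝ) ^ 2 * τ) * d n := by
    intro τ hτ
    refine Summable.of_norm_bounded hds.norm fun n => ?_
    rw [norm_mul, Real.norm_of_nonneg (Real.exp_pos _).le]
    refine mul_le_of_le_one_left (norm_nonneg _) (Real.exp_le_one_iff.2 ?_)
    have : 0 ≤ (n + 1 : ℝ) ^ 2 * τ := by positivity
    linarith
  have hval : ∀ τ : ℝ, 0 ≤ τ → f (stepResponse g τ) =
      (∑' n, d n) - ∑' n : ℕ, Real.exp (-(n + 1 : ℝ) ^ 2 * τ) * d n := by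
    intro τ hτ
    rw [← hds.tsum_sub (hes τ hτ), ← (hasSum_clm_apply f (stepResponse g τ)).tsum_eq]
    congr 1
    ext n
    rw [inner_stepResponse, modeResponse, max_eq_left hτ]
    simp only [hd, hc]
    ring
  have hlim := tendsto_tsum_exp_mul (k := fun n => (n + 1 : ℝ) ^ 2) hds
    (fun n => Or.inr (sq_nonneg _))
  have hne : ∀ n : ℕ, (n + 1 : ℝ) ^ 2 ≠ 0 := fun n => by positivity
  simp only [hne, if_false, tsum_zero] at hlim
  -- A decreasing function lies above its limit, so the exponential sum, which is the limit minus
  -- the value at τ, is nonpositive for every τ ≥ 0.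
  have hdN : d N ≤ 0 := by
    refine leading_coeff_nonpos hds (fun n hn => by simp [hd, hc, hN n hn]) fun τ hτ => ?_
    refine ge_of_tendsto hlim ?_
    filter_upwards [Filter.eventually_ge_atTop τ] with σ hσ
    have := hf τ σ hτ hσ
    rw [hval τ hτ, hval σ (hτ.trans hσ)] at this
    linarith
  have : c N = d N * (N + 1 : ℝ) ^ 2 := by
    rw [hd]
    field_simp
  change c N ≤ 0
  rw [this]
  exact mul_nonpos_of_nonpos_of_nonneg hdN (sq_nonneg _)

/-- A point outside the closure is separated from it by a functional f, and the first mode on which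
f does not vanish supplies the N and σ excluded by `h`. -/
theorem dense_reachable (b₁ b₂ : State) (C : Matrix (Fin 2) (Fin 2) ℝ)
    (h : ∀ N : ℕ, ∀ σ : ℝ, σ ≠ 0 →
      ¬ ∀ k : Fin 2, inner ℝ (sineMode N) (inputOp b₁ b₂ fun i => C i k) * σ ≤ 0) :
    Dense (reachable b₁ b₂ C) := by
  intro x
  by_contra hx
  obtain ⟨f, w, hfw, hwx⟩ := geometric_hahn_banach_closed_point
    (convex_reachable b₁ b₂ C).closure isClosed_closure hx
  have hw : 0 < w := by
    simpa using hfw 0 (subset_closure (zero_mem_reachable b₁ b₂ C))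
  have hfneg : ∀ z ∈ reachable b₁ b₂ C, f z ≤ 0 := by
    intro z hz
    by_contra! hpos
    -- Scaling z by w / f z would give a reachable state where f equals w, against strict
    -- separation.
    have hmem := lincomb_mem_reachable hz (zero_mem_reachable b₁ b₂ C)
      (div_nonneg hw.le hpos.le) le_rfl
    have := hfw _ (subset_closure hmem)
    simp [hpos.ne'] at this
  have hex : ∃ n, f (sineMode n) ≠ 0 := by
    by_contra! hall
    have := (hasSum_clm_apply f x).unique (a₂ := 0) (by simp [hall, hasSum_zero])
    linarith
  classical
  refine h (Nat.find hex) _ (Nat.find_spec hex) fun k => ?_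
  refine inner_mul_nonpos_of_antitone (fun r s hr hrs => ?_)
    fun n hn => not_not.1 (Nat.find_min hex hn)
  have := hfneg _ (stepResponse_sub_mem_reachable b₁ b₂ (col_mem_cone C k) hr hrs)
  rw [map_sub] at this
  linarith

/-! ### From density to controllability from any initial state. -/

/-- A state reached from 0 near the target can be reached as late as desired, when the free
evolution of φ is already small. -/
theorem approxControllable_of_dense {b₁ b₂ : State} {C : Matrix (Fin 2) (Fin 2) ℝ}
    (h : Dense (reachable b₁ b₂ C)) (φ : State) : ApproxControllable b₁ b₂ (cone C) φ := by
  intro x₁ ε hε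
  obtain ⟨z, ⟨T, hT, hz⟩, hzx⟩ := h.exists_dist_lt x₁ (half_pos hε)
  have hlim : Filter.Tendsto (fun t => Real.exp (-t) * ‖φ‖) Filter.atTop (nhds 0) := by
    simpa using Real.tendsto_exp_neg_atTop_nhds_zero.mul_const ‖φ‖
  obtain ⟨t, hsmall, htT⟩ := ((hlim.eventually_lt_const (half_pos hε)).and
    (Filter.eventually_ge_atTop T)).exists
  have ht : 0 < t := hT.trans_le htT
  obtain ⟨u, x, hu, hx, hxt⟩ := hz t htT
  have hsol := hx.lincomb (isWeakSolution_freeEvolution b₁ b₂ φ)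
    (fun t ht i => hu.intervalIntegrable ht i) (fun t _ i => intervalIntegrable_const) 1 1
  simp only [one_smul, zero_add, add_zero] at hsol
  refine ⟨u, t, _, hu, ht, hsol, ?_⟩
  simp only [hxt]
  rw [← sub_sub]
  rw [dist_eq_norm] at hzx
  have := norm_sub_le (x₁ - z) (freeEvolution φ t)
  have := norm_freeEvolution_le φ ht.le
  linarith

/-! ### Necessity: a mode that cannot be pushed upward. -/

/-- A continuous solution of `a' = -κ a + r` in integrated form, with `κ ≥ 0` and `r ≤ 0`, stays
below every nonnegative bound on its initial value. -/
theorem le_of_integral_decay {a r : ℝ → ℝ} {κ M : ℝ} (hκ : 0 ≤ κ) (hM : 0 ≤ M)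
    (ha : ContinuousOn a (Ici 0)) (h0 : a 0 ≤ M)
    (hr : ∀ t, 0 ≤ t → IntervalIntegrable r volume 0 t)
    (hrneg : ∀ᵐ s ∂(volume.restrict (Ici (0 : ℝ))), r s ≤ 0)
    (heq : ∀ t, 0 ≤ t → a t = a 0 + ∫ s in (0 : ℝ)..t, (-κ * a s + r s)) {t : ℝ} (ht : 0 ≤ t) :
    a t ≤ M := by
  by_contra! hlt
  have hac : ContinuousOn a (Icc 0 t) := ha.mono Icc_subset_Ici_self
  -- After the last time τ at which a ≤ M, the integrand is nonpositive, so a cannot have risen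
  -- above M.
  set S := {s ∈ Icc 0 t | a s ≤ M} with hS
  have hSc : IsCompact S := by
    refine isCompact_Icc.of_isClosed_subset ?_ (sep_subset _ _)
    exact hac.preimage_isClosed_of_isClosed isClosed_Icc isClosed_Iic
  obtain ⟨τ, ⟨hτI, hτM⟩, hτmax⟩ := hSc.exists_isGreatest ⟨0, ⟨le_rfl, ht⟩, h0⟩
  have hgt : ∀ s ∈ Ioc τ t, M < a s := by
    intro s hs
    by_contra! hle
    exact absurd (hτmax ⟨⟨hτI.1.trans hs.1.le, hs.2⟩, hle⟩) (not_le.2 hs.1)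
  have hint : ∀ s, 0 ≤ s → IntervalIntegrable (fun s => -κ * a s + r s) volume 0 s := by
    intro s hs
    refine IntervalIntegrable.add (ContinuousOn.intervalIntegrable ?_) (hr s hs)
    rw [uIcc_of_le hs]
    exact continuousOn_const.mul (ha.mono Icc_subset_Ici_self)
  have hsub := intervalIntegral.integral_interval_sub_left (hint t ht) (hint τ hτI.1)
  have hneg : ∫ s in τ..t, (-κ * a s + r s) ≤ 0 := by
    rw [intervalIntegral.integral_of_le hτI.2]
    refine integral_nonpos_of_ae ?_
    have h1 := ae_restrict_of_ae_restrict_of_subset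
      (fun s (hs : s ∈ Ioc τ t) => mem_Ici.2 (hτI.1.trans hs.1.le)) hrneg
    filter_upwards [h1, ae_restrict_mem measurableSet_Ioc] with s hs1 hs2
    have := mul_nonneg hκ (hM.trans (hgt s hs2).le)
    simp only [Pi.zero_apply]
    linarith
  have e1 := heq t ht
  have e2 := heq τ hτI.1
  linarith

theorem inDomain_sin (j : ℤ) : InDomain fun ξ => Real.sin ((j : ℝ) * ξ) := by
  refine ⟨ContDiff.contDiffOn (by fun_prop), by simp, Real.sin_int_mul_pi j⟩

theorem laplacian_sin (j : ℤ) : EqOn (laplacian fun ξ => Real.sin ((j : ℝ) * ξ))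
    (fun ξ => -(j : ℝ) ^ 2 * Real.sin ((j : ℝ) * ξ)) (Icc 0 Real.pi) := by
  intro ξ hξ
  have hu := uniqueDiffOn_Icc Real.pi_pos
  have h1 : EqOn (derivWithin (fun ξ => Real.sin ((j : ℝ) * ξ)) (Icc 0 Real.pi))
      (fun ξ => (j : ℝ) * Real.cos ((j : ℝ) * ξ)) (Icc 0 Real.pi) := by
    intro η hη
    have := ((hasDerivAt_id η).const_mul (j : ℝ)).sin
    refine (this.congr_deriv ?_).hasDerivWithinAt.derivWithin (hu η hη)
    simp [mul_comm]
  have h2 := (((hasDerivAt_id ξ).const_mul (j : ℝ)).cos).const_mul (j : ℝ)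
  rw [laplacian, iteratedDerivWithin_succ]
  refine HasDerivWithinAt.derivWithin ?_ (hu ξ hξ)
  refine (h2.congr_deriv ?_).hasDerivWithinAt.congr (fun η hη => ?_) ?_
  · simp
    ring
  · rw [iteratedDerivWithin_one]
    exact h1 hη
  · rw [iteratedDerivWithin_one]
    exact h1 hξ

theorem pairing_inputOp_mulVec (b₁ b₂ : State) (C : Matrix (Fin 2) (Fin 2) ℝ) (w : Fin 2 → ℝ)
    {y : ℝ → ℝ} (hy : ContinuousOn y (Icc 0 Real.pi)) :
    pairing (inputOp b₁ b₂ (C.mulVec w)) y = w 0 * pairing (inputOp b₁ b₂ fun i => C i 0) y +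
      w 1 * pairing (inputOp b₁ b₂ fun i => C i 1) y := by
  rw [← pairing_lincomb _ _ _ _ hy, ← inputOp_lincomb]
  congr 2
  ext i
  simp [Matrix.mulVec, dotProduct, mul_comm]

/-- Testing the weak equation with y = sin(jξ) gives a' = -j² a + r with r ≤ 0 for a = (x, y), so
(x(t), y) never exceeds |(φ, y)|. -/
theorem not_approxControllable {b₁ b₂ φ : State} {C : Matrix (Fin 2) (Fin 2) ℝ} {j : ℤ}
    (hj : j ≠ 0)
    (h : ∀ k : Fin 2, pairing (inputOp b₁ b₂ fun i => C i k) (fun ξ => Real.sin ((j : ℝ) * ξ)) ≤ 0) :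
    ¬ ApproxControllable b₁ b₂ (cone C) φ := by
  intro hctrl
  set y : ℝ → ℝ := fun ξ => Real.sin ((j : ℝ) * ξ) with hy
  have hyD : InDomain y := inDomain_sin j
  have hlap : ∀ z, pairing z (laplacian y) = -(j : ℝ) ^ 2 * pairing z y := by
    intro z
    rw [pairing_congr z (laplacian_sin j), pairing, pairing, ← intervalIntegral.integral_const_mul]
    congr 1
    ext ξ
    ring
  set Y := (memLp_of_continuousOn hyD.continuousOn).toLp y with hY
  have hpair : ∀ z, pairing z y = inner ℝ z Y :=
    fun z => pairing_eq_inner z (memLp_of_continuousOn hyD.continuousOn)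
  have hY0 : 0 < ‖Y‖ := by
    rw [norm_pos_iff]
    intro h0
    have h1 : inner ℝ Y Y = Real.pi / 2 := by
      rw [hY, inner_toLp_toLp]
      simp only [hy, ← sq]
      have hj' : (j : ℝ) ≠ 0 := by exact_mod_cast hj
      rw [intervalIntegral.integral_comp_mul_left (fun ξ => Real.sin ξ ^ 2) hj', integral_sin_sq]
      simp [Real.sin_int_mul_pi]
      field_simp
    rw [h0, inner_zero_left] at h1
    linarith [Real.pi_pos]
  set M := |pairing φ y| with hMdef
  -- The target pairs with y to exactly M + 1, and an error below 1/‖Y‖ changes the pairing by less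
  -- than 1.
  obtain ⟨u, t, x, hu, ht, hx, hclose⟩ :=
    hctrl (((M + 1) / ‖Y‖ ^ 2) • Y) (1 / ‖Y‖) (by positivity)
  have hle : pairing (x t) y ≤ M := by
    refine le_of_integral_decay (a := fun s => pairing (x s) y)
      (r := fun s => pairing (inputOp b₁ b₂ (u s)) y) (sq_nonneg (j : ℝ)) (abs_nonneg _) ?_ ?_
      (fun t ht => intervalIntegrable_pairing_inputOp b₁ b₂
        (fun i => hu.intervalIntegrable ht i) hyD.continuousOn) ?_ ?_ ht.le
    · simp_rw [hpair]
      exact hx.1.inner continuousOn_const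
    · simpa only [hx.2.1] using le_abs_self _
    · filter_upwards [hu.2] with s hs
      obtain ⟨w, hw0, hw1, hw⟩ := hs
      rw [hw, pairing_inputOp_mulVec _ _ _ _ hyD.continuousOn]
      have h0 := mul_nonpos_of_nonneg_of_nonpos hw0 (h 0)
      have h1 := mul_nonpos_of_nonneg_of_nonpos hw1 (h 1)
      linarith
    · intro t ht
      have := hx.2.2 y hyD t ht
      simp_rw [hlap] at this
      simpa only [hx.2.1] using this
  have hgap : inner ℝ (((M + 1) / ‖Y‖ ^ 2) • Y - x t) Y < 1 := by
    refine (real_inner_le_norm _ _).trans_lt ?_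
    rwa [← lt_div_iff₀ hY0]
  rw [inner_sub_left, real_inner_smul_left, real_inner_self_eq_norm_sq,
    div_mul_cancel₀ _ (by positivity), ← hpair] at hgap
  linarith

/-! ### Translation into the stated integrals. -/

theorem integral_coeff_eq_pairing (b₁ b₂ : State) (C : Matrix (Fin 2) (Fin 2) ℝ) (k : Fin 2)
    (y : ℝ → ℝ) :
    ∫ ξ in (0 : ℝ)..Real.pi, (b₁ ξ * C 0 k + b₂ ξ * C 1 k) * y ξ =
      pairing (inputOp b₁ b₂ fun i => C i k) y := by
  rw [pairing_eq_setIntegral, intervalIntegral.integral_of_le Real.pi_pos.le,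
    ← integral_Icc_eq_integral_Ioc]
  refine integral_congr_ae ?_
  filter_upwards [Lp.coeFn_add (C 0 k • b₁) (C 1 k • b₂), Lp.coeFn_smul (C 0 k) b₁,
    Lp.coeFn_smul (C 1 k) b₂] with ξ h1 h2 h3
  rw [inputOp, h1, Pi.add_apply, h2, h3]
  simp only [Pi.smul_apply, smul_eq_mul]
  ring

theorem pairing_sin_neg (x : State) (r : ℝ) :
    pairing x (fun ξ => Real.sin (-r * ξ)) = -pairing x (fun ξ => Real.sin (r * ξ)) := by
  simp [pairing]

end HeatControl

theorem theorem4 (b₁ b₂ : HeatControl.State) (C : Matrix (Fin 2) (Fin 2) ℝ)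
    (φ : HeatControl.State) :
    HeatControl.ApproxControllable b₁ b₂ (HeatControl.cone C) φ ↔
      ¬ ∃ j : ℤ, j ≠ 0 ∧
        (∫ ξ in (0 : ℝ)..Real.pi,
          (b₁ ξ * C 0 0 + b₂ ξ * C 1 0) * Real.sin ((j : ℝ) * ξ)) ≤ 0 ∧
        (∫ ξ in (0 : ℝ)..Real.pi,
          (b₁ ξ * C 0 1 + b₂ ξ * C 1 1) * Real.sin ((j : ℝ) * ξ)) ≤ 0 := by
  simp_rw [fun (j : ℤ) k => HeatControl.integral_coeff_eq_pairing b₁ b₂ C k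
    fun ξ => Real.sin ((j : ℝ) * ξ)]
  constructor
  · rintro hctrl ⟨j, hj, h0, h1⟩
    exact HeatControl.not_approxControllable hj (Fin.forall_fin_two.2 ⟨h0, h1⟩) hctrl
  · intro h
    refine HeatControl.approxControllable_of_dense (HeatControl.dense_reachable b₁ b₂ C ?_) φ
    intro N σ hσ hall
    have hc : (0 : ℝ) < √(2 / Real.pi) := by positivity
    simp_rw [HeatControl.inner_sineMode, mul_assoc] at hall
    have hall' := fun k => nonpos_of_mul_nonpos_right (hall k) hc
    -- The sign of σ becomes the sign of j: for σ < 0 both pairings with sin((N+1)ξ) are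
    -- nonnegative, and oddness of sine reverses them.
    rcases lt_or_gt_of_ne hσ with hneg | hpos
    · refine h ⟨-(N + 1 : ℤ), by omega, ?_, ?_⟩ <;>
      · push_cast
        rw [HeatControl.pairing_sin_neg, neg_nonpos]
        exact nonneg_of_mul_nonpos_left (hall' _) hneg
    · refine h ⟨(N + 1 : ℤ), by omega, ?_, ?_⟩ <;>
      · push_cast
        exact nonpos_of_mul_nonpos_left (hall' _) hpos
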